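/- Let $X_1, X_2, \ldots$ be i.i.d. random variables taking values in a measurable space $\mathcal{X}$, let $\Theta$ be a measurable space, let $f : \Theta \times \mathcal{X} \to [0,1]$ be a measurable function, let $P_0$ be a probability measure on $\Theta$ (the prior, which does not depend on the sample), and let $\delta \in (0,1]$. For $\theta \in \Theta$ and $n \ge 1$ put $\mu_\theta := \mathbb{E}[f(\theta, X_1)]$ and $\hat\mu_\theta := \frac1n \sum_{i=1}^n f(\theta, X_i)$. For $p, q \in [0,1]$ let $$\mathsf{kl}(p,q) := p \ln\frac{p}{q} + (1-p) \ln\frac{1-p}{1-q} \in [0,\infty]$$ be the Kullback–Leibler divergence between the Bernoulli distributions with parameters $p$ and $q$, with the conventions $0 \ln \frac{0}{q} = 0$ and $p \ln \frac{p}{0} = \infty$ for $p > 0$. A data-dependent distribution for sample size $n$ is a probability kernel $P$ from $\mathcal{X}^n$ to $\Theta$, and we write $P_n := P(X_1, \ldots, X_n)$. Put $$\mathcal{C}_n := \mathsf{KL}(P_n \,\|\, P_0) + \ln \frac{\sqrt{\pi}\, \Gamma(n+1)}{\Gamma(n+\frac12)},$$ where $\mathsf{KL}(P_n \,\|\, P_0)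 := \int \ln \frac{\mathrm{d}P_n}{\mathrm{d}P_0}\, \mathrm{d}P_n$ if $P_n \ll P_0$ and $\mathsf{KL}(P_n \,\|\, P_0) := \infty$ otherwise. Then, with probability at least $1-\delta$, simultaneously for all integers $n \ge 1$ and all data-dependent distributions $P_n$, $$\mathsf{kl}\Big(\int \hat\mu_\theta \,\mathrm{d}P_n(\theta),\ \int \mu_\theta \,\mathrm{d}P_n(\theta)\Big) \le \frac{\mathcal{C}_n + \ln\frac1\delta}{n}.$$ -/

import Mathlib

open MeasureTheory ProbabilityTheory InformationTheory

namespace PACBayes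

/-- The term `p ln (p / q)`, for `p, q ∈ [0, 1]`, with the usual conventions
`0 ln (0 / q) = 0` and `p ln (p / 0) = ∞` for `p > 0`. -/
noncomputable def klTerm (p q : ℝ) : EReal :=
  if p = 0 then 0 else if q = 0 then ⊤ else ((p * Real.log (p / q) : ℝ) : EReal)

/-- The Kullback-Leibler divergence between the Bernoulli distributions with parameters
`p, q ∈ [0, 1]`, namely `p ln (p / q) + (1 - p) ln ((1 - p) / (1 - q))`, with values in
`[0, ∞]`. -/
noncomputable def bernoulliKL (p q : ℝ) : EReal :=
  klTerm p q + klTerm (1 - p) (1 - q)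

/-- The empirical mean `(1 / n) ∑ f (θ, xᵢ)` of a sample `x` of size `n`. -/
noncomputable def empiricalMean {Θ 𝒳 : Type*} (f : Θ → 𝒳 → ℝ) {n : ℕ} (x : Fin n → 𝒳)
    (θ : Θ) : ℝ :=
  (∑ i, f θ (x i)) / n

/-- The mean `𝔼 [f (θ, Y)]` for a random element `Y`. -/
noncomputable def trueMean {Θ 𝒳 Ω : Type*} [MeasurableSpace Ω] (f : Θ → 𝒳 → ℝ)
    (P : Measure Ω) (Y : Ω → 𝒳) (θ : Θ) : ℝ :=
  ∫ ω, f θ (Y ω) ∂P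

/-- The complexity `KL (Q ‖ P₀) + ln (√π Γ(n + 1) / Γ(n + 1 / 2))` of a posterior `Q` relative to
a prior `P₀`, with values in `[0, ∞]`. -/
noncomputable def complexity {Θ : Type*} [MeasurableSpace Θ] (n : ℕ) (Q P₀ : Measure Θ) : EReal :=
  (klDiv Q P₀ : EReal) +
    ((Real.log (√Real.pi * Real.Gamma ((n : ℝ) + 1) / Real.Gamma ((n : ℝ) + 1 / 2)) : ℝ) : EReal)

end PACBayes

/-! By Jensen's inequality for the jointly convex function `kl` and the Donsker-Varadhan
inequality, `n kl (∫ μ̂ dQ, ∫ μ dQ) ≤ KL (Q ‖ P₀) + log ∫ exp (n kl (μ̂_θ, μ_θ)) dP₀(θ)` for every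
`Q`, so only the last integral, in which `Q` does not occur, has to be controlled. Its integrand
is at most `√π Γ(n + 1) / Γ(n + 1 / 2)` times the average over `q ~ Beta (1 / 2, 1 / 2)` of the
likelihood ratios of the means `q` and `μ_θ` (the Krichevsky-Trofimov mixture). Counts of
successes being real for observations in `[0, 1]`, this comes from the concavity of
`log Γ(s + 1 / 2) - s log s` on `[0, ∞)`. The average of the likelihood ratios over `θ` and `q` is
a nonnegative supermartingale with initial value `1`, which by Ville's inequality stays below
`1 / δ` at all times with probability at least `1 - δ`. -/

open scoped ENNReal Topology

namespace PACBayes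

lemma concaveOn_of_tendsto {ι E : Type*} [AddCommGroup E] [Module ℝ E] {l : Filter ι} [l.NeBot]
    {s : Set E} {F : ι → E → ℝ} {g : E → ℝ} (hF : ∀ i, ConcaveOn ℝ s (F i))
    (hlim : ∀ x ∈ s, Filter.Tendsto (fun i => F i x) l (𝓝 (g x))) : ConcaveOn ℝ s g := by
  obtain ⟨i₀⟩ := l.nonempty_of_neBot
  exact ⟨(hF i₀).1, fun _ hx _ hy _ _ ha hb hab =>
    le_of_tendsto_of_tendsto' (((hlim _ hx).const_smul _).add ((hlim _ hy).const_smul _))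
      (hlim _ ((hF i₀).1 hx hy ha hb hab)) fun i => (hF i).2 hx hy ha hb hab⟩

lemma concaveOn_sum {ι E : Type*} [AddCommGroup E] [Module ℝ E] {s : Set E} (hs : Convex ℝ s)
    {F : ι → E → ℝ} (t : Finset ι) (hF : ∀ i ∈ t, ConcaveOn ℝ s (F i)) :
    ConcaveOn ℝ s fun x => ∑ i ∈ t, F i x := by
  induction t using Finset.cons_induction with
  | empty => simpa using concaveOn_const 0 hs
  | cons i t hi ih =>
    simp only [Finset.sum_cons]
    exact (hF i (Finset.mem_cons_self i t)).add
      (ih fun j hj => hF j (Finset.mem_cons_of_mem hj))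

lemma add_le_add_of_concaveOn_Ici {h : ℝ → ℝ} (hh : ConcaveOn ℝ (Set.Ici 0) h) {a b : ℝ}
    (ha : 0 ≤ a) (hb : 0 ≤ b) : h 0 + h (a + b) ≤ h a + h b := by
  rcases (add_nonneg ha hb).eq_or_lt with hab | hab
  · obtain ⟨rfl, rfl⟩ : a = 0 ∧ b = 0 := ⟨by linarith, by linarith⟩
    rw [add_zero]
  have hsum : a / (a + b) + b / (a + b) = 1 := by rw [← add_div, div_self hab.ne']
  have hconv {c d : ℝ} (hc : 0 ≤ c) (hd : 0 ≤ d) (hcd : c / (a + b) + d / (a + b) = 1) :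
      c / (a + b) * h (a + b) + d / (a + b) * h 0 ≤ h c := by
    simpa [div_mul_cancel₀ _ hab.ne'] using hh.2 (Set.mem_Ici.2 hab.le)
      Set.self_mem_Ici (div_nonneg hc hab.le) (div_nonneg hd hab.le) hcd
  have hle_a := hconv ha hb hsum
  have hle_b := hconv hb ha (by rwa [add_comm])
  linear_combination hle_a + hle_b - (h 0 + h (a + b)) * hsum

lemma concaveOn_neg_mul_log_add {c : ℝ} (hc : 0 ≤ c) :
    ConcaveOn ℝ (Set.Ici 0) fun s : ℝ => -((s + c) * Real.log (s + c)) :=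
  (Real.convexOn_mul_log.neg.translate_left c).subset (fun _ hs => add_nonneg hc hs)
    (convex_Ici 0) |>.congr fun s _ => by simp

/-- The increment of `s log s` over `[s, s + 1]`, minus `log (s + 1 / 2)`. Euler's limit for
`log Γ (s + 1 / 2) - s log s` is a sum of such terms. -/
noncomputable def mulLogIncrement (s : ℝ) : ℝ :=
  (s + 1) * Real.log (s + 1) - s * Real.log s - Real.log (s + 1 / 2)

lemma hasDerivAt_mulLogIncrement {s : ℝ} (hs : 0 < s) :
    HasDerivAt mulLogIncrement (Real.log (s + 1) - Real.log s - (s + 1 / 2)⁻¹) s := by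
  have h₁ := (Real.hasDerivAt_mul_log (by positivity : s + 1 ≠ 0)).comp_add_const s 1
  have h₂ := (Real.hasDerivAt_log (by positivity : s + 1 / 2 ≠ 0)).comp_add_const s (1 / 2)
  exact ((h₁.sub (Real.hasDerivAt_mul_log hs.ne')).sub h₂).congr_deriv (by ring)

lemma hasDerivAt_deriv_mulLogIncrement {s : ℝ} (hs : 0 < s) :
    HasDerivAt (fun s : ℝ => Real.log (s + 1) - Real.log s - (s + 1 / 2)⁻¹)
      (-(4 * s * (s + 1) * (s + 1 / 2) ^ 2)⁻¹) s := by
  have h₁ := (Real.hasDerivAt_log (by positivity : s + 1 ≠ 0)).comp_add_const s 1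
  have h₂ := (hasDerivAt_inv (by positivity : s + 1 / 2 ≠ 0)).comp_add_const s (1 / 2)
  refine ((h₁.sub (Real.hasDerivAt_log hs.ne')).sub h₂).congr_deriv ?_
  field_simp
  ring

lemma concaveOn_mulLogIncrement : ConcaveOn ℝ (Set.Ici 0) mulLogIncrement := by
  have hpos {s : ℝ} (hs : s ∈ interior (Set.Ici (0 : ℝ))) : 0 < s := by
    rwa [interior_Ici] at hs
  have hcont : ContinuousOn mulLogIncrement (Set.Ici 0) := by
    refine ((Real.continuous_mul_log.comp (continuous_add_const 1)).sub
      Real.continuous_mul_log).continuousOn.sub (ContinuousOn.log (by fun_prop) fun s hs => ?_)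
    have : (0 : ℝ) ≤ s := hs
    positivity
  refine concaveOn_of_hasDerivWithinAt2_nonpos (convex_Ici 0) hcont
    (fun s hs => (hasDerivAt_mulLogIncrement (hpos hs)).hasDerivWithinAt)
    (fun s hs => (hasDerivAt_deriv_mulLogIncrement (hpos hs)).hasDerivWithinAt) fun s hs => ?_
  have := hpos hs
  exact neg_nonpos.2 (by positivity)

lemma concaveOn_mulLogIncrement_add {c : ℝ} (hc : 0 ≤ c) :
    ConcaveOn ℝ (Set.Ici 0) fun s => mulLogIncrement (s + c) :=
  (concaveOn_mulLogIncrement.translate_left c).subset (fun _ hs => add_nonneg hc hs)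
    (convex_Ici 0) |>.congr fun s _ => by simp

lemma sum_range_mulLogIncrement (s : ℝ) (n : ℕ) :
    ∑ j ∈ Finset.range n, mulLogIncrement (s + j) =
      (s + n) * Real.log (s + n) - s * Real.log s
        - ∑ j ∈ Finset.range n, Real.log (s + 1 / 2 + j) := by
  have htele := Finset.sum_range_sub (fun j : ℕ => (s + j) * Real.log (s + j)) n
  rw [Nat.cast_zero, add_zero] at htele
  rw [← htele, ← Finset.sum_sub_distrib]
  refine Finset.sum_congr rfl fun j _ => ?_
  rw [mulLogIncrement, Nat.cast_succ, add_assoc s, add_right_comm]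

lemma logGammaSeq_sub_mul_log (s : ℝ) (n : ℕ) :
    Real.BohrMollerup.logGammaSeq (s + 1 / 2) n - s * Real.log s =
      (s * Real.log n + (1 / 2 * Real.log n + Real.log n.factorial))
        + ∑ j ∈ Finset.range (n + 1), mulLogIncrement (s + j)
        + -((s + (n + 1 : ℕ)) * Real.log (s + (n + 1 : ℕ))) := by
  rw [Real.BohrMollerup.logGammaSeq, sum_range_mulLogIncrement]
  ring

lemma concaveOn_log_Gamma_sub_mul_log :
    ConcaveOn ℝ (Set.Ici 0) fun s => Real.log (Real.Gamma (s + 1 / 2)) - s * Real.log s := by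
  have hconv := convex_Ici (𝕜 := ℝ) (0 : ℝ)
  have hlin (k : ℝ) : ConcaveOn ℝ (Set.Ici 0) fun s : ℝ => s * k :=
    (LinearMap.mulRight ℝ k).concaveOn hconv
  refine concaveOn_of_tendsto (l := Filter.atTop) (fun n => ?_) fun s hs =>
    (Real.BohrMollerup.tendsto_log_gamma (add_pos_of_nonneg_of_pos hs one_half_pos)).sub_const _
  simp only [logGammaSeq_sub_mul_log]
  exact (((hlin _).add (concaveOn_const _ hconv)).add
    (concaveOn_sum hconv _ fun j _ => concaveOn_mulLogIncrement_add j.cast_nonneg)).add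
    (concaveOn_neg_mul_log_add (Nat.cast_nonneg _))

lemma rpow_self_mul_rpow_self_mul_Gamma_le {a b : ℝ} (ha : 0 ≤ a) (hb : 0 ≤ b) :
    a ^ a * b ^ b * (Real.Gamma (1 / 2) * Real.Gamma (a + b + 1 / 2)) ≤
      (a + b) ^ (a + b) * (Real.Gamma (a + 1 / 2) * Real.Gamma (b + 1 / 2)) := by
  have hΓ {s : ℝ} (hs : 0 ≤ s) : 0 < Real.Gamma (s + 1 / 2) := Real.Gamma_pos_of_pos (by positivity)
  have hpow {s : ℝ} (hs : 0 ≤ s) : s ^ s = Real.exp (s * Real.log s) := by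
    rcases hs.eq_or_lt with rfl | hs
    · simp
    · rw [Real.rpow_def_of_pos hs, mul_comm]
  have hΓexp {s : ℝ} (hs : 0 ≤ s) :
      Real.Gamma (s + 1 / 2) = Real.exp (Real.log (Real.Gamma (s + 1 / 2))) :=
    (Real.exp_log (hΓ hs)).symm
  have hconcave := add_le_add_of_concaveOn_Ici concaveOn_log_Gamma_sub_mul_log ha hb
  have hab := add_nonneg ha hb
  have hΓ0 := hΓexp le_rfl
  rw [zero_mul, sub_zero] at hconcave
  rw [zero_add] at hΓ0 hconcave
  rw [hpow ha, hpow hb, hpow hab, hΓ0, hΓexp ha, hΓexp hb, hΓexp hab]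
  simp only [← Real.exp_add]
  exact Real.exp_le_exp.2 (by linarith)

/-- The regret `√π Γ(s + 1) / Γ(s + 1 / 2)` of the Krichevsky-Trofimov mixture after `s`
observations: the factor lost when the best Bernoulli parameter in hindsight is replaced by the
average over the Jeffreys prior `Beta (1 / 2, 1 / 2)`. -/
noncomputable def ktRegret (s : ℝ) : ℝ :=
  √Real.pi * Real.Gamma (s + 1) / Real.Gamma (s + 1 / 2)

lemma ktRegret_pos {s : ℝ} (hs : 0 ≤ s) : 0 < ktRegret s := by
  have := Real.Gamma_pos_of_pos (by positivity : 0 < s + 1)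
  have := Real.Gamma_pos_of_pos (by positivity : 0 < s + 1 / 2)
  unfold ktRegret
  positivity

lemma rpow_div_add_mul_rpow_div_add_le {a b : ℝ} (ha : 0 ≤ a) (hb : 0 ≤ b) :
    (a / (a + b)) ^ a * (b / (a + b)) ^ b ≤
      ktRegret (a + b) * (beta (a + 1 / 2) (b + 1 / 2) / beta (1 / 2) (1 / 2)) := by
  have hab := add_nonneg ha hb
  have : 0 < Real.Gamma (1 / 2) := Real.Gamma_pos_of_pos one_half_pos
  have : 0 < Real.Gamma (a + b + 1) := Real.Gamma_pos_of_pos (by positivity)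
  have : 0 < Real.Gamma (a + b + 1 / 2) := Real.Gamma_pos_of_pos (by positivity)
  have hpow : 0 < (a + b) ^ (a + b) := by
    rcases hab.eq_or_lt with h | h
    · simp [← h]
    · exact Real.rpow_pos_of_pos h _
  have hratio : ktRegret (a + b) * (beta (a + 1 / 2) (b + 1 / 2) / beta (1 / 2) (1 / 2)) =
      Real.Gamma (a + 1 / 2) * Real.Gamma (b + 1 / 2) /
        (Real.Gamma (1 / 2) * Real.Gamma (a + b + 1 / 2)) := by
    have hsum : a + 1 / 2 + (b + 1 / 2) = a + b + 1 := by ring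
    rw [ktRegret, beta, beta, hsum, add_halves, Real.Gamma_one, ← Real.Gamma_one_half_eq]
    field_simp
  rw [hratio, Real.div_rpow ha hab, Real.div_rpow hb hab, div_mul_div_comm,
    ← Real.rpow_add_of_nonneg hab ha hb, div_le_div_iff₀ hpow (by positivity),
    mul_comm (_ * _) (_ ^ (a + b))]
  exact rpow_self_mul_rpow_self_mul_Gamma_le ha hb

lemma measurable_betaPDF (α β : ℝ) : Measurable (betaPDF α β) :=
  (measurable_betaPDFReal α β).ennreal_ofReal

lemma ae_mem_Ioo_betaMeasure (α β : ℝ) : ∀ᵐ q ∂betaMeasure α β, q ∈ Set.Ioo (0 : ℝ) 1 := by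
  rw [betaMeasure, ae_withDensity_iff (measurable_betaPDF α β)]
  refine ae_of_all _ fun q hq => ⟨?_, ?_⟩
  · exact not_le.1 (mt betaPDF_eq_zero_of_nonpos hq)
  · exact not_le.1 (mt betaPDF_eq_zero_of_one_le hq)

lemma betaPDF_mul_rpow_mul_rpow {α β a b : ℝ} (hα : 0 < α) (hβ : 0 < β) (ha : 0 ≤ a)
    (hb : 0 ≤ b) (q : ℝ) :
    betaPDF α β q * (ENNReal.ofReal q ^ a * ENNReal.ofReal (1 - q) ^ b) =
      ENNReal.ofReal (beta (a + α) (b + β) / beta α β) * betaPDF (a + α) (b + β) q := by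
  have hB := beta_pos hα hβ
  have hB' : 0 < beta (a + α) (b + β) := beta_pos (by positivity) (by positivity)
  rcases le_or_gt q 0 with h0 | h0
  · simp [betaPDF_eq_zero_of_nonpos h0]
  rcases le_or_gt 1 q with h1 | h1
  · simp [betaPDF_eq_zero_of_one_le h1]
  have h1' : 0 < 1 - q := sub_pos.2 h1
  rw [betaPDF_of_pos_lt_one h0 h1, betaPDF_of_pos_lt_one h0 h1,
    ENNReal.ofReal_rpow_of_pos h0, ENNReal.ofReal_rpow_of_pos h1',
    ← ENNReal.ofReal_mul (by positivity), ← ENNReal.ofReal_mul (by positivity),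
    ← ENNReal.ofReal_mul (by positivity)]
  congr 1
  rw [add_sub_assoc, add_sub_assoc, Real.rpow_add h0, Real.rpow_add h1']
  field_simp

lemma lintegral_rpow_mul_rpow_betaMeasure {α β a b : ℝ} (hα : 0 < α) (hβ : 0 < β) (ha : 0 ≤ a)
    (hb : 0 ≤ b) :
    ∫⁻ q, ENNReal.ofReal q ^ a * ENNReal.ofReal (1 - q) ^ b ∂betaMeasure α β =
      ENNReal.ofReal (beta (a + α) (b + β) / beta α β) := by
  rw [betaMeasure, lintegral_withDensity_eq_lintegral_mul _ (measurable_betaPDF α β) (by fun_prop)]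
  simp_rw [Pi.mul_apply, betaPDF_mul_rpow_mul_rpow hα hβ ha hb]
  rw [lintegral_const_mul _ (measurable_betaPDF _ _),
    lintegral_betaPDF_eq_one (by positivity) (by positivity), mul_one]

lemma rpow_mul_rpow_le_ktRegret_mul_lintegral {a b : ℝ} (ha : 0 ≤ a) (hb : 0 ≤ b) (s t : ℝ≥0∞) :
    (ENNReal.ofReal (a / (a + b)) / s) ^ a * (ENNReal.ofReal (b / (a + b)) / t) ^ b ≤
      ENNReal.ofReal (ktRegret (a + b)) * ∫⁻ q, (ENNReal.ofReal q / s) ^ a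
        * (ENNReal.ofReal (1 - q) / t) ^ b ∂betaMeasure (1 / 2) (1 / 2) := by
  have hfactor (u v : ℝ≥0∞) : (u / s) ^ a * (v / t) ^ b =
      u ^ a * v ^ b * ((s ^ a)⁻¹ * (t ^ b)⁻¹) := by
    rw [ENNReal.div_rpow_of_nonneg _ _ ha, ENNReal.div_rpow_of_nonneg _ _ hb, div_eq_mul_inv,
      div_eq_mul_inv, mul_mul_mul_comm]
  simp_rw [hfactor]
  rw [lintegral_mul_const _ (by fun_prop), ← mul_assoc (ENNReal.ofReal (ktRegret _)),
    lintegral_rpow_mul_rpow_betaMeasure one_half_pos one_half_pos ha hb,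
    ENNReal.ofReal_rpow_of_nonneg (by positivity) ha,
    ENNReal.ofReal_rpow_of_nonneg (by positivity) hb, ← ENNReal.ofReal_mul (by positivity),
    ← ENNReal.ofReal_mul (ktRegret_pos (add_nonneg ha hb)).le]
  gcongr ENNReal.ofReal ?_ * _
  exact rpow_div_add_mul_rpow_div_add_le ha hb

lemma rpow_mul_rpow_le_ofReal_mul_add {w : ℝ} (hw : w ∈ Set.Icc (0 : ℝ) 1) (u v : ℝ≥0∞) :
    u ^ w * v ^ (1 - w) ≤ ENNReal.ofReal w * u + ENNReal.ofReal (1 - w) * v := by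
  rcases hw.1.eq_or_lt with rfl | h0
  · simp
  rcases hw.2.eq_or_lt with rfl | h1
  · simp
  have h1' : 0 < 1 - w := sub_pos.2 h1
  by_cases hu : u = ∞
  · simp [hu, ENNReal.mul_top, h0]
  by_cases hv : v = ∞
  · simp [hv, ENNReal.mul_top, h1]
  lift u to NNReal using hu
  lift v to NNReal using hv
  have hw' : w.toNNReal + (1 - w).toNNReal = 1 := by
    rw [← Real.toNNReal_add h0.le h1'.le, add_sub_cancel, Real.toNNReal_one]
  have hamgm := NNReal.geom_mean_le_arith_mean2_weighted _ _ u v hw'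
  rw [Real.coe_toNNReal _ h0.le, Real.coe_toNNReal _ h1'.le] at hamgm
  rw [← ENNReal.coe_rpow_of_nonneg _ h0.le, ← ENNReal.coe_rpow_of_nonneg _ h1'.le]
  simp only [ENNReal.ofReal]
  exact_mod_cast hamgm

/-- The expectation under `Bernoulli x` of the likelihood ratio of `Bernoulli q` to
`Bernoulli m`: the factor by which an observation `x ∈ [0, 1]` multiplies the wealth of a gambler
who bets on the mean `q` against the mean `m`. -/
noncomputable def bernoulliLikelihoodRatio (m q x : ℝ) : ℝ≥0∞ :=
  ENNReal.ofReal x * (ENNReal.ofReal q / ENNReal.ofReal m)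
    + ENNReal.ofReal (1 - x) * (ENNReal.ofReal (1 - q) / ENNReal.ofReal (1 - m))

lemma measurable_bernoulliLikelihoodRatio {α : Type*} [MeasurableSpace α] {m q x : α → ℝ}
    (hm : Measurable m) (hq : Measurable q) (hx : Measurable x) :
    Measurable fun z => bernoulliLikelihoodRatio (m z) (q z) (x z) := by
  unfold bernoulliLikelihoodRatio
  fun_prop

lemma rpow_sum_of_nonneg (u : ℝ≥0∞) {ι : Type*} (s : Finset ι) {x : ι → ℝ}
    (hx : ∀ i ∈ s, 0 ≤ x i) : u ^ (∑ i ∈ s, x i) = ∏ i ∈ s, u ^ x i := by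
  induction s using Finset.cons_induction with
  | empty => simp
  | cons i s hi ih =>
    rw [Finset.forall_mem_cons] at hx
    rw [Finset.sum_cons, Finset.prod_cons,
      ENNReal.rpow_add_of_nonneg _ _ hx.1 (Finset.sum_nonneg hx.2), ih hx.2]

lemma rpow_sum_mul_rpow_sum_le_prod {ι : Type*} (s : Finset ι) {x : ι → ℝ}
    (hx : ∀ i, x i ∈ Set.Icc (0 : ℝ) 1) (m q : ℝ) :
    (ENNReal.ofReal q / ENNReal.ofReal m) ^ (∑ i ∈ s, x i)
        * (ENNReal.ofReal (1 - q) / ENNReal.ofReal (1 - m)) ^ (∑ i ∈ s, (1 - x i)) ≤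
      ∏ i ∈ s, bernoulliLikelihoodRatio m q (x i) := by
  rw [rpow_sum_of_nonneg _ s fun i _ => (hx i).1,
    rpow_sum_of_nonneg _ s fun i _ => sub_nonneg.2 (hx i).2, ← Finset.prod_mul_distrib]
  exact Finset.prod_le_prod' fun i _ => rpow_mul_rpow_le_ofReal_mul_add (hx i) _ _

lemma lintegral_bernoulliLikelihoodRatio_le_one {Ω : Type*} [MeasurableSpace Ω] {P : Measure Ω}
    [IsProbabilityMeasure P] {Z : Ω → ℝ} (hZm : Measurable Z)
    (hZ : ∀ ω, Z ω ∈ Set.Icc (0 : ℝ) 1) {q : ℝ} (hq : q ∈ Set.Icc (0 : ℝ) 1) :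
    ∫⁻ ω, bernoulliLikelihoodRatio (∫ ω, Z ω ∂P) q (Z ω) ∂P ≤ 1 := by
  have hint : Integrable Z P := Integrable.of_mem_Icc 0 1 hZm.aemeasurable (ae_of_all _ hZ)
  have hint' : Integrable (fun ω => 1 - Z ω) P := (integrable_const 1).sub hint
  have hmean : ∫⁻ ω, ENNReal.ofReal (Z ω) ∂P = ENNReal.ofReal (∫ ω, Z ω ∂P) :=
    (ofReal_integral_eq_lintegral_ofReal hint (ae_of_all _ fun ω => (hZ ω).1)).symm
  have hmean' : ∫⁻ ω, ENNReal.ofReal (1 - Z ω) ∂P = ENNReal.ofReal (1 - ∫ ω, Z ω ∂P) := by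
    rw [← ofReal_integral_eq_lintegral_ofReal hint' (ae_of_all _ fun ω => sub_nonneg.2 (hZ ω).2),
      integral_sub (integrable_const 1) hint, integral_const, probReal_univ, one_smul]
  unfold bernoulliLikelihoodRatio
  rw [lintegral_add_left (by fun_prop), lintegral_mul_const _ (by fun_prop),
    lintegral_mul_const _ (by fun_prop), hmean, hmean']
  calc _ ≤ ENNReal.ofReal q + ENNReal.ofReal (1 - q) :=
        add_le_add ENNReal.mul_div_le ENNReal.mul_div_le
    _ = 1 := by
        rw [← ENNReal.ofReal_add hq.1 (sub_nonneg.2 hq.2), add_sub_cancel, ENNReal.ofReal_one]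

lemma exp_klTerm {p q : ℝ} (hp : 0 ≤ p) (hq : 0 ≤ q) :
    EReal.exp (klTerm p q) = (ENNReal.ofReal p / ENNReal.ofReal q) ^ p := by
  rcases hp.eq_or_lt with rfl | hp
  · simp [klTerm]
  rcases hq.eq_or_lt with rfl | hq
  · simp [klTerm, hp.ne', hp, ENNReal.div_zero]
  rw [klTerm, if_neg hp.ne', if_neg hq.ne', EReal.exp_coe, ← ENNReal.ofReal_div_of_pos hq,
    ENNReal.ofReal_rpow_of_pos (div_pos hp hq), Real.rpow_def_of_pos (div_pos hp hq), mul_comm]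

lemma exp_natCast_mul_bernoulliKL (n : ℕ) {p q : ℝ} (hp : p ∈ Set.Icc (0 : ℝ) 1)
    (hq : q ∈ Set.Icc (0 : ℝ) 1) :
    EReal.exp (n * bernoulliKL p q) = (ENNReal.ofReal p / ENNReal.ofReal q) ^ (p * n) *
      (ENNReal.ofReal (1 - p) / ENNReal.ofReal (1 - q)) ^ ((1 - p) * n) := by
  rw [bernoulliKL, EReal.exp_nmul, EReal.exp_add, exp_klTerm hp.1 hq.1,
    exp_klTerm (sub_nonneg.2 hp.2) (sub_nonneg.2 hq.2), mul_pow, ENNReal.rpow_mul_natCast,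
    ENNReal.rpow_mul_natCast]

lemma exp_mul_bernoulliKL_le_lintegral_prod {n : ℕ} (hn : n ≠ 0) {x : Fin n → ℝ}
    (hx : ∀ i, x i ∈ Set.Icc (0 : ℝ) 1) {m : ℝ} (hm : m ∈ Set.Icc (0 : ℝ) 1) :
    EReal.exp (n * bernoulliKL ((∑ i, x i) / n) m) ≤ ENNReal.ofReal (ktRegret n) *
      ∫⁻ q, ∏ i, bernoulliLikelihoodRatio m q (x i) ∂betaMeasure (1 / 2) (1 / 2) := by
  have hn' : (0 : ℝ) < n := by exact_mod_cast hn.bot_lt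
  set a := ∑ i, x i
  set b := ∑ i, (1 - x i)
  have ha : 0 ≤ a := Finset.sum_nonneg fun i _ => (hx i).1
  have hb : 0 ≤ b := Finset.sum_nonneg fun i _ => sub_nonneg.2 (hx i).2
  have hab : a + b = n := by
    rw [← Finset.sum_add_distrib]
    simp
  have hcompl : 1 - a / n = b / n := by
    rw [← hab, eq_div_iff (by linarith), sub_mul, div_mul_cancel₀ _ (by linarith)]
    ring
  have hmem : a / n ∈ Set.Icc (0 : ℝ) 1 :=
    ⟨div_nonneg ha hn'.le, sub_nonneg.1 (hcompl ▸ div_nonneg hb hn'.le)⟩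
  calc EReal.exp (n * bernoulliKL (a / n) m)
      = (ENNReal.ofReal (a / (a + b)) / ENNReal.ofReal m) ^ a *
          (ENNReal.ofReal (b / (a + b)) / ENNReal.ofReal (1 - m)) ^ b := by
        rw [exp_natCast_mul_bernoulliKL n hmem hm, hcompl, div_mul_cancel₀ _ hn'.ne',
          div_mul_cancel₀ _ hn'.ne', hab]
    _ ≤ ENNReal.ofReal (ktRegret n) * ∫⁻ q, (ENNReal.ofReal q / ENNReal.ofReal m) ^ a *
          (ENNReal.ofReal (1 - q) / ENNReal.ofReal (1 - m)) ^ b ∂betaMeasure (1 / 2) (1 / 2) :=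
        hab ▸ rpow_mul_rpow_le_ktRegret_mul_lintegral ha hb _ _
    _ ≤ _ := by
        gcongr with q
        exact rpow_sum_mul_rpow_sum_le_prod Finset.univ hx m q

lemma ofReal_integral_le_lintegral {α : Type*} [MeasurableSpace α] {μ : Measure α} {g : α → ℝ}
    (hg : Integrable g μ) : ENNReal.ofReal (∫ a, g a ∂μ) ≤ ∫⁻ a, ENNReal.ofReal (g a) ∂μ := by
  rw [integral_eq_lintegral_pos_part_sub_lintegral_neg_part hg]
  exact (ENNReal.ofReal_le_ofReal (sub_le_self _ ENNReal.toReal_nonneg)).trans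
    ENNReal.ofReal_toReal_le

/-- The I-divergence `x ln (x / y) + y - x` of `x, y ≥ 0`, with value `∞` for `x > 0 = y`. In
contrast to `klTerm` it is nonnegative, and `bernoulliKL p q` is the sum of its values at `(p, q)`
and `(1 - p, 1 - q)`. -/
noncomputable def iDivergence (x y : ℝ) : ℝ≥0∞ :=
  if y = 0 ∧ x ≠ 0 then ⊤ else ENNReal.ofReal (x * Real.log (x / y) + y - x)

lemma mul_log_add_mul_one_sub_le {x y r : ℝ} (hx : 0 ≤ x) (hy : 0 ≤ y) (hxy : y = 0 → x = 0)
    (hr : 0 < r) : x * Real.log r + y * (1 - r) ≤ x * Real.log (x / y) + y - x := by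
  rcases hx.eq_or_lt with rfl | hx
  · linarith [mul_nonneg hy hr.le]
  have hy : 0 < y := hy.lt_of_ne' (mt hxy hx.ne')
  have hlog := mul_le_mul_of_nonneg_left
    (Real.log_le_sub_one_of_pos (by positivity : 0 < r / (x / y))) hx.le
  have hcancel : x * (r / (x / y) - 1) = y * r - x := by field_simp
  rw [Real.log_div hr.ne' (by positivity), hcancel] at hlog
  linarith

lemma ofReal_mul_log_add_mul_one_sub_le_iDivergence {x y r : ℝ} (hx : 0 ≤ x) (hy : 0 ≤ y)
    (hr : 0 < r) : ENNReal.ofReal (x * Real.log r + y * (1 - r)) ≤ iDivergence x y := by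
  unfold iDivergence
  split_ifs with h
  · exact le_top
  · exact ENNReal.ofReal_le_ofReal
      (mul_log_add_mul_one_sub_le hx hy (by simpa using h) hr)

-- Together with the previous lemma: the I-divergence is the supremum of these linear functions.
lemma iDivergence_le_of_forall_pos {x y : ℝ} (hx : 0 ≤ x) (hy : 0 ≤ y) {c : ℝ≥0∞}
    (hc : ∀ r > 0, ENNReal.ofReal (x * Real.log r + y * (1 - r)) ≤ c) : iDivergence x y ≤ c := by
  rcases hx.eq_or_lt with rfl | hx
  · have hlim : Filter.Tendsto (fun r : ℝ => ENNReal.ofReal (0 * Real.log r + y * (1 - r)))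
        (𝓝[>] 0) (𝓝 (ENNReal.ofReal y)) := by
      have hcont : Continuous fun r : ℝ => ENNReal.ofReal (y * (1 - r)) :=
        ENNReal.continuous_ofReal.comp (by fun_prop)
      simpa using (hcont.tendsto 0).mono_left nhdsWithin_le_nhds
    simpa [iDivergence] using le_of_tendsto hlim (eventually_mem_nhdsWithin.mono hc)
  rcases hy.eq_or_lt with rfl | hy
  · have hlim : Filter.Tendsto (fun r : ℝ => ENNReal.ofReal (x * Real.log r + 0 * (1 - r)))
        Filter.atTop (𝓝 ⊤) := by
      simp only [zero_mul, add_zero]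
      exact ENNReal.tendsto_ofReal_atTop.comp (Real.tendsto_log_atTop.const_mul_atTop hx)
    exact le_top.trans (le_of_tendsto hlim ((Filter.eventually_gt_atTop 0).mono hc))
  · have hval : x * Real.log (x / y) + y - x = x * Real.log (x / y) + y * (1 - x / y) := by
      field_simp
      ring
    rw [iDivergence, if_neg fun h => hy.ne' h.1, hval]
    exact hc _ (div_pos hx hy)

lemma iDivergence_integral_le {α : Type*} [MeasurableSpace α] {μ : Measure α} {u v : α → ℝ}
    (hu : Integrable u μ) (hv : Integrable v μ) (hu0 : ∀ a, 0 ≤ u a) (hv0 : ∀ a, 0 ≤ v a) :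
    iDivergence (∫ a, u a ∂μ) (∫ a, v a ∂μ) ≤ ∫⁻ a, iDivergence (u a) (v a) ∂μ := by
  refine iDivergence_le_of_forall_pos (integral_nonneg hu0) (integral_nonneg hv0) fun r hr => ?_
  rw [← integral_mul_const, ← integral_mul_const,
    ← integral_add (hu.mul_const _) (hv.mul_const _)]
  exact (ofReal_integral_le_lintegral ((hu.mul_const _).add (hv.mul_const _))).trans
    (lintegral_mono fun a =>
      ofReal_mul_log_add_mul_one_sub_le_iDivergence (hu0 a) (hv0 a) hr)

lemma coe_iDivergence {x y : ℝ} (hx : 0 ≤ x) (hy : 0 ≤ y) :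
    (iDivergence x y : EReal) = klTerm x y + ((y - x : ℝ) : EReal) := by
  unfold iDivergence
  split_ifs with h
  · simp [klTerm, h.1, h.2]
  have hxy : y = 0 → x = 0 := by simpa using h
  have hterm : klTerm x y = ((x * Real.log (x / y) : ℝ) : EReal) := by
    rcases eq_or_ne x 0 with rfl | hx0
    · simp [klTerm]
    · rw [klTerm, if_neg hx0, if_neg (mt hxy hx0)]
  have hnonneg : 0 ≤ x * Real.log (x / y) + y - x := by
    simpa using mul_log_add_mul_one_sub_le hx hy hxy one_pos
  rw [EReal.coe_ennreal_ofReal, max_eq_left hnonneg, hterm, ← EReal.coe_add, add_sub_assoc]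

lemma bernoulliKL_eq_coe {p q : ℝ} (hp : p ∈ Set.Icc (0 : ℝ) 1) (hq : q ∈ Set.Icc (0 : ℝ) 1) :
    bernoulliKL p q = ((iDivergence p q + iDivergence (1 - p) (1 - q) : ℝ≥0∞) : EReal) := by
  have hcancel : q - p + (1 - q - (1 - p)) = 0 := by ring
  rw [EReal.coe_ennreal_add, coe_iDivergence hp.1 hq.1,
    coe_iDivergence (sub_nonneg.2 hp.2) (sub_nonneg.2 hq.2), add_add_add_comm, ← EReal.coe_add,
    hcancel, EReal.coe_zero, add_zero, bernoulliKL]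

lemma bernoulliKL_nonneg {p q : ℝ} (hp : p ∈ Set.Icc (0 : ℝ) 1) (hq : q ∈ Set.Icc (0 : ℝ) 1) :
    0 ≤ bernoulliKL p q :=
  bernoulliKL_eq_coe hp hq ▸ EReal.coe_ennreal_nonneg _

lemma measurable_klTerm {α : Type*} [MeasurableSpace α] {u v : α → ℝ} (hu : Measurable u)
    (hv : Measurable v) : Measurable fun a => klTerm (u a) (v a) :=
  Measurable.ite (hu (measurableSet_singleton 0)) measurable_const
    (Measurable.ite (hv (measurableSet_singleton 0)) measurable_const
      (hu.mul (hu.div hv).log).coe_real_ereal)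

lemma measurable_bernoulliKL {α : Type*} [MeasurableSpace α] {u v : α → ℝ} (hu : Measurable u)
    (hv : Measurable v) : Measurable fun a => bernoulliKL (u a) (v a) :=
  (measurable_klTerm hu hv).add
    (measurable_klTerm (measurable_const.sub hu) (measurable_const.sub hv))

lemma bernoulliKL_integral_le {α : Type*} [MeasurableSpace α] {μ : Measure α}
    [IsProbabilityMeasure μ] {u v : α → ℝ} (hu : Integrable u μ) (hv : Integrable v μ)
    (hu01 : ∀ a, u a ∈ Set.Icc (0 : ℝ) 1) (hv01 : ∀ a, v a ∈ Set.Icc (0 : ℝ) 1) :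
    bernoulliKL (∫ a, u a ∂μ) (∫ a, v a ∂μ) ≤
      ((∫⁻ a, (bernoulliKL (u a) (v a)).toENNReal ∂μ : ℝ≥0∞) : EReal) := by
  have hmem {w : α → ℝ} (hw : Integrable w μ) (hw01 : ∀ a, w a ∈ Set.Icc (0 : ℝ) 1) :
      ∫ a, w a ∂μ ∈ Set.Icc (0 : ℝ) 1 :=
    (convex_Icc 0 1).integral_mem isClosed_Icc (ae_of_all _ hw01) hw
  have hcompl {w : α → ℝ} (hw : Integrable w μ) : 1 - ∫ a, w a ∂μ = ∫ a, 1 - w a ∂μ := by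
    rw [integral_sub (integrable_const 1) hw, integral_const, probReal_univ, one_smul]
  have hcongr (a : α) : (bernoulliKL (u a) (v a)).toENNReal =
      iDivergence (u a) (v a) + iDivergence (1 - u a) (1 - v a) := by
    rw [bernoulliKL_eq_coe (hu01 a) (hv01 a), EReal.toENNReal_coe]
  simp_rw [hcongr]
  rw [bernoulliKL_eq_coe (hmem hu hu01) (hmem hv hv01), hcompl hu, hcompl hv,
    EReal.coe_ennreal_le_coe_ennreal_iff]
  exact (add_le_add
    (iDivergence_integral_le hu hv (fun a => (hu01 a).1) fun a => (hv01 a).1)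
    (iDivergence_integral_le ((integrable_const 1).sub hu) ((integrable_const 1).sub hv)
      (fun a => sub_nonneg.2 (hu01 a).2) fun a => sub_nonneg.2 (hv01 a).2)).trans
    (le_lintegral_add _ _)

section DonskerVaradhan

variable {Θ : Type*} [MeasurableSpace Θ] {Q P₀ : Measure Θ} [IsProbabilityMeasure Q]
  [IsProbabilityMeasure P₀]

/-- Tilting `P₀` by `g` gives a probability measure `P₀.tilted g` with
`0 ≤ KL (Q ‖ P₀.tilted g) = KL (Q ‖ P₀) - ∫ g dQ + log ∫ exp g dP₀`. -/
lemma integral_le_toReal_klDiv_add_log_integral_exp {g : Θ → ℝ} (hKL : klDiv Q P₀ ≠ ∞)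
    (hgQ : Integrable g Q) (hgP₀ : Integrable (fun θ => Real.exp (g θ)) P₀) :
    ∫ θ, g θ ∂Q ≤ (klDiv Q P₀).toReal + Real.log (∫ θ, Real.exp (g θ) ∂P₀) := by
  obtain ⟨hac, hllr⟩ := klDiv_ne_top_iff.1 hKL
  have := isProbabilityMeasure_tilted hgP₀
  have hac' : Q ≪ P₀.tilted g := hac.trans (absolutelyContinuous_tilted hgP₀)
  have hnonneg := integral_llr_add_sub_measure_univ_nonneg hac'
    (integrable_llr_tilted_right hac hgQ hllr hgP₀)
  rw [integral_llr_tilted_right hac hgQ hgP₀ hllr, probReal_univ, probReal_univ,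
    ← toReal_klDiv_of_measure_eq hac (by simp)] at hnonneg
  linarith

lemma lintegral_le_klDiv_add_log_lintegral_exp_of_le {h : Θ → ℝ≥0∞} (hh : Measurable h)
    (hKL : klDiv Q P₀ ≠ ∞) {k : ℕ} (hk : ∀ θ, h θ ≤ k) :
    ((∫⁻ θ, h θ ∂Q : ℝ≥0∞) : EReal) ≤
      klDiv Q P₀ + ENNReal.log (∫⁻ θ, EReal.exp (h θ) ∂P₀) := by
  have hfin (θ : Θ) : h θ ≠ ∞ := ((hk θ).trans_lt (ENNReal.natCast_lt_top k)).ne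
  have hmem (θ : Θ) : (h θ).toReal ∈ Set.Icc (0 : ℝ) k :=
    ⟨ENNReal.toReal_nonneg, ENNReal.toReal_le_of_le_ofReal k.cast_nonneg (by simpa using hk θ)⟩
  have hgQ : Integrable (fun θ => (h θ).toReal) Q :=
    Integrable.of_mem_Icc 0 k hh.ennreal_toReal.aemeasurable (ae_of_all _ hmem)
  have hgP₀ : Integrable (fun θ => Real.exp (h θ).toReal) P₀ :=
    Integrable.of_mem_Icc 0 (Real.exp k) hh.ennreal_toReal.exp.aemeasurable
      (ae_of_all _ fun θ => ⟨(Real.exp_pos _).le, Real.exp_le_exp.2 (hmem θ).2⟩)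
  have hint : ((∫⁻ θ, h θ ∂Q : ℝ≥0∞) : EReal) = ((∫ θ, (h θ).toReal ∂Q : ℝ) : EReal) := by
    have hlt : ∫⁻ θ, h θ ∂Q < ∞ := (lintegral_mono hk).trans_lt (by simp)
    rw [integral_toReal hh.aemeasurable (ae_of_all _ fun θ => (hfin θ).lt_top),
      EReal.coe_ennreal_toReal hlt.ne]
  have hexp : ENNReal.log (∫⁻ θ, EReal.exp (h θ) ∂P₀) =
      ((Real.log (∫ θ, Real.exp (h θ).toReal ∂P₀) : ℝ) : EReal) := by
    have hcoe (θ : Θ) : EReal.exp (h θ) = ENNReal.ofReal (Real.exp (h θ).toReal) := by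
      rw [← EReal.exp_coe, EReal.coe_ennreal_toReal (hfin θ)]
    simp_rw [hcoe]
    rw [← ofReal_integral_eq_lintegral_ofReal hgP₀ (ae_of_all _ fun θ => (Real.exp_pos _).le),
      ENNReal.log_ofReal_of_pos (integral_exp_pos hgP₀)]
  rw [hint, hexp, ← EReal.coe_ennreal_toReal hKL, ← EReal.coe_add, EReal.coe_le_coe_iff]
  exact integral_le_toReal_klDiv_add_log_integral_exp hKL hgQ hgP₀

lemma lintegral_le_klDiv_add_log_lintegral_exp {h : Θ → ℝ≥0∞} (hh : Measurable h) :
    ((∫⁻ θ, h θ ∂Q : ℝ≥0∞) : EReal) ≤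
      klDiv Q P₀ + ENNReal.log (∫⁻ θ, EReal.exp (h θ) ∂P₀) := by
  rcases eq_or_ne (klDiv Q P₀) ∞ with hKL | hKL
  · have hone : 1 ≤ ∫⁻ θ, EReal.exp (h θ) ∂P₀ := by
      rw [← measure_univ (μ := P₀), ← lintegral_one]
      exact lintegral_mono fun θ => EReal.exp_zero ▸ EReal.exp_monotone (EReal.coe_ennreal_nonneg _)
    rw [hKL, EReal.coe_ennreal_top, EReal.top_add_of_ne_bot
      (ne_bot_of_gt (EReal.bot_lt_zero.trans_le (ENNReal.zero_le_log_iff.2 hone)))]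
    exact le_top
  have hle (k : ℕ) : ((∫⁻ θ, min (h θ) k ∂Q : ℝ≥0∞) : EReal) ≤
      klDiv Q P₀ + ENNReal.log (∫⁻ θ, EReal.exp (h θ) ∂P₀) := by
    refine (lintegral_le_klDiv_add_log_lintegral_exp_of_le (hh.min measurable_const) hKL
      fun θ => min_le_right _ _).trans ?_
    gcongr with θ
    exact EReal.coe_ennreal_le_coe_ennreal_iff.2 (min_le_left _ _)
  have hlim : Filter.Tendsto (fun k : ℕ => ∫⁻ θ, min (h θ) k ∂Q) Filter.atTop
      (𝓝 (∫⁻ θ, h θ ∂Q)) := by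
    refine lintegral_tendsto_of_tendsto_of_monotone
      (fun k => (hh.min measurable_const).aemeasurable)
      (ae_of_all _ fun θ j k hjk => min_le_min_left (h θ) (Nat.cast_le.2 hjk))
      (ae_of_all _ fun θ => ?_)
    simpa using tendsto_const_nhds (x := h θ) |>.min ENNReal.tendsto_nat_nhds_top
  exact le_of_tendsto' (continuous_coe_ennreal_ereal.tendsto _ |>.comp hlim) hle

lemma natCast_mul_bernoulliKL_integral_le {u v : Θ → ℝ} (hu : Measurable u) (hv : Measurable v)
    (hu01 : ∀ θ, u θ ∈ Set.Icc (0 : ℝ) 1) (hv01 : ∀ θ, v θ ∈ Set.Icc (0 : ℝ) 1) (n : ℕ) :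
    n * bernoulliKL (∫ θ, u θ ∂Q) (∫ θ, v θ ∂Q) ≤
      klDiv Q P₀ + ENNReal.log (∫⁻ θ, EReal.exp (n * bernoulliKL (u θ) (v θ)) ∂P₀) := by
  have hcast : ((n : ℝ≥0∞) : EReal) = n := rfl
  have hmeas : Measurable fun θ => (bernoulliKL (u θ) (v θ)).toENNReal :=
    (measurable_bernoulliKL hu hv).ereal_toENNReal
  have hcoe (θ : Θ) : n * bernoulliKL (u θ) (v θ) =
      ((n * (bernoulliKL (u θ) (v θ)).toENNReal : ℝ≥0∞) : EReal) := by
    rw [EReal.coe_ennreal_mul, hcast,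
      EReal.coe_toENNReal (bernoulliKL_nonneg (hu01 θ) (hv01 θ))]
  calc n * bernoulliKL (∫ θ, u θ ∂Q) (∫ θ, v θ ∂Q)
      ≤ n * ((∫⁻ θ, (bernoulliKL (u θ) (v θ)).toENNReal ∂Q : ℝ≥0∞) : EReal) := by
        gcongr
        exact bernoulliKL_integral_le (Integrable.of_mem_Icc 0 1 hu.aemeasurable (ae_of_all _ hu01))
          (Integrable.of_mem_Icc 0 1 hv.aemeasurable (ae_of_all _ hv01)) hu01 hv01
    _ = ((∫⁻ θ, n * (bernoulliKL (u θ) (v θ)).toENNReal ∂Q : ℝ≥0∞) : EReal) := by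
        rw [lintegral_const_mul _ hmeas, EReal.coe_ennreal_mul, hcast]
    _ ≤ _ := by
        simp_rw [hcoe]
        exact lintegral_le_klDiv_add_log_lintegral_exp (hmeas.const_mul _)

end DonskerVaradhan

section Ville

variable {Ω : Type*} [mΩ : MeasurableSpace Ω] {P : Measure Ω} {ℱ : Filtration ℕ mΩ}
  {M : ℕ → Ω → ℝ≥0∞}

/-- A supermartingale with values in `[0, ∞]`. Unlike for `MeasureTheory.Supermartingale`, no
integrability is required, and the inequality of conditional expectations is stated through
integrals over the events of the past. -/
structure IsENNRealSupermartingale (M : ℕ → Ω → ℝ≥0∞) (ℱ : Filtration ℕ mΩ) (P : Measure Ω) :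
    Prop where
  measurable (n : ℕ) : Measurable[ℱ n] (M n)
  setLIntegral_succ_le (n : ℕ) {s : Set Ω} (hs : MeasurableSet[ℱ n] s) :
    ∫⁻ ω in s, M (n + 1) ω ∂P ≤ ∫⁻ ω in s, M n ω ∂P

namespace IsENNRealSupermartingale

lemma mul_measure_inter_exists_le (hM : IsENNRealSupermartingale M ℱ P) (c : ℝ≥0∞) (n m : ℕ)
    {s : Set Ω} (hs : MeasurableSet[ℱ m] s) :
    c * P (s ∩ {ω | ∃ k ≤ n, c ≤ M (m + k) ω}) ≤ ∫⁻ ω in s, M m ω ∂P := by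
  have hexceed (j : ℕ) : MeasurableSet[ℱ j] {ω | c ≤ M j ω} := hM.measurable j measurableSet_Ici
  have hnow (j : ℕ) {t : Set Ω} (ht : MeasurableSet[ℱ j] t) :
      c * P (t ∩ {ω | c ≤ M j ω}) ≤ ∫⁻ ω in t ∩ {ω | c ≤ M j ω}, M j ω ∂P := by
    rw [← setLIntegral_const]
    exact setLIntegral_mono' (ℱ.le j _ (ht.inter (hexceed j))) fun ω hω => hω.2
  induction n generalizing m s with
  | zero =>
    simpa using (hnow m hs).trans (lintegral_mono_set Set.inter_subset_left)
  | succ n ih =>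
    have hrest : MeasurableSet[ℱ m] (s \ {ω | c ≤ M m ω}) := hs.diff (hexceed m)
    have hlater : c * P ((s \ {ω | c ≤ M m ω}) ∩ {ω | ∃ k ≤ n, c ≤ M (m + 1 + k) ω}) ≤
        ∫⁻ ω in s \ {ω | c ≤ M m ω}, M m ω ∂P :=
      (ih (m + 1) (ℱ.mono m.le_succ _ hrest)).trans (hM.setLIntegral_succ_le m hrest)
    have hsplit : s ∩ {ω | ∃ k ≤ n + 1, c ≤ M (m + k) ω} ⊆ (s ∩ {ω | c ≤ M m ω}) ∪
        ((s \ {ω | c ≤ M m ω}) ∩ {ω | ∃ k ≤ n, c ≤ M (m + 1 + k) ω}) := by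
      rintro ω ⟨hωs, k, hk, hω⟩
      by_cases hωm : c ≤ M m ω
      · exact .inl ⟨hωs, hωm⟩
      · obtain _ | k := k
        · exact absurd hω hωm
        · exact .inr ⟨⟨hωs, hωm⟩, k, by omega, by rwa [add_right_comm, add_assoc]⟩
    calc c * P (s ∩ {ω | ∃ k ≤ n + 1, c ≤ M (m + k) ω})
        ≤ c * P (s ∩ {ω | c ≤ M m ω}) +
          c * P ((s \ {ω | c ≤ M m ω}) ∩ {ω | ∃ k ≤ n, c ≤ M (m + 1 + k) ω}) := by
          rw [← mul_add]
          gcongr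
          exact (measure_mono hsplit).trans (measure_union_le _ _)
      _ ≤ ∫⁻ ω in s ∩ {ω | c ≤ M m ω}, M m ω ∂P + ∫⁻ ω in s \ {ω | c ≤ M m ω}, M m ω ∂P :=
          add_le_add (hnow m hs) hlater
      _ = ∫⁻ ω in s, M m ω ∂P := lintegral_inter_add_sdiff _ s (ℱ.le m _ (hexceed m))

lemma mul_measure_exists_le (hM : IsENNRealSupermartingale M ℱ P) (c : ℝ≥0∞) :
    c * P {ω | ∃ n, c ≤ M n ω} ≤ ∫⁻ ω, M 0 ω ∂P := by
  have hunion : {ω | ∃ n, c ≤ M n ω} = ⋃ n, {ω | ∃ k ≤ n, c ≤ M k ω} := by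
    ext ω
    simp only [Set.mem_ofPred_eq, Set.mem_iUnion]
    exact ⟨fun ⟨n, hn⟩ => ⟨n, n, le_rfl, hn⟩, fun ⟨_, k, _, hk⟩ => ⟨k, hk⟩⟩
  have hmono : Monotone fun n => {ω | ∃ k ≤ n, c ≤ M k ω} :=
    fun _ _ hmn _ ⟨k, hk, hω⟩ => ⟨k, hk.trans hmn, hω⟩
  rw [hunion, hmono.measure_iUnion, ENNReal.mul_iSup]
  refine iSup_le fun n => ?_
  simpa using hM.mul_measure_inter_exists_le c n 0 MeasurableSet.univ

lemma exists_measurableSet_forall_le [IsProbabilityMeasure P]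
    (hM : IsENNRealSupermartingale M ℱ P) (hM0 : ∫⁻ ω, M 0 ω ∂P ≤ 1) {δ : ℝ} (hδ : 0 < δ) :
    ∃ E, MeasurableSet E ∧ 1 - δ ≤ P.real E ∧
      ∀ ω ∈ E, ∀ n, M n ω ≤ ENNReal.ofReal (1 / δ) := by
  have hexceed : MeasurableSet {ω | ∃ n, ENNReal.ofReal (1 / δ) ≤ M n ω} := by
    rw [Set.ofPred_exists]
    exact .iUnion fun n => ℱ.le n _ (hM.measurable n measurableSet_Ici)
  have hprob : P {ω | ∃ n, ENNReal.ofReal (1 / δ) ≤ M n ω} ≤ ENNReal.ofReal δ := by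
    have hville := (hM.mul_measure_exists_le (ENNReal.ofReal (1 / δ))).trans hM0
    rwa [mul_comm, ← ENNReal.le_inv_iff_mul_le, ← ENNReal.ofReal_inv_of_pos (one_div_pos.2 hδ),
      one_div, inv_inv, ← one_div] at hville
  refine ⟨_, hexceed.compl, ?_, fun ω hω n => le_of_not_ge fun h => hω ⟨n, h⟩⟩
  rw [probReal_compl_eq_one_sub hexceed]
  gcongr
  exact ENNReal.toReal_le_of_le_ofReal hδ.le hprob

lemma lintegral {S : Type*} [MeasurableSpace S] {ρ : Measure S} [SFinite ρ] [SFinite P]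
    {M : S → ℕ → Ω → ℝ≥0∞}
    (hmeas : ∀ n, Measurable[(ℱ n).prod inferInstance] fun z : Ω × S => M z.2 n z.1)
    (hM : ∀ᵐ s ∂ρ, IsENNRealSupermartingale (M s) ℱ P) :
    IsENNRealSupermartingale (fun n ω => ∫⁻ s, M s n ω ∂ρ) ℱ P where
  measurable n := @Measurable.lintegral_prod_right' _ _ (ℱ n) _ _ _ _ (hmeas n)
  setLIntegral_succ_le n s hs := by
    have hmeas' (k : ℕ) : Measurable fun z : Ω × S => M z.2 k z.1 :=
      (hmeas k).mono (sup_le_sup_right (MeasurableSpace.comap_mono (ℱ.le k)) _) le_rfl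
    have hswap (k : ℕ) :
        ∫⁻ ω in s, ∫⁻ a, M a k ω ∂ρ ∂P = ∫⁻ a, ∫⁻ ω in s, M a k ω ∂P ∂ρ :=
      lintegral_lintegral_swap (hmeas' k).aemeasurable
    rw [hswap, hswap]
    exact lintegral_mono_ae (hM.mono fun a ha => ha.setLIntegral_succ_le n hs)

end IsENNRealSupermartingale

/-- The filtration of the strict past of a process: time `n` knows `X i` for `i < n` only, whereas
`MeasureTheory.Filtration.natural` also knows `X n`. -/
def pastFiltration {𝒳 : Type*} [MeasurableSpace 𝒳] {X : ℕ → Ω → 𝒳} (hX : ∀ i, Measurable (X i)) :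
    Filtration ℕ mΩ where
  seq n := ⨆ i ∈ Set.Iio n, MeasurableSpace.comap (X i) inferInstance
  mono' _ _ hmn := biSup_mono fun _ hi => lt_of_lt_of_le hi hmn
  le' _ := iSup₂_le fun i _ => (hX i).comap_le

variable {𝒳 : Type*} [MeasurableSpace 𝒳] {X : ℕ → Ω → 𝒳}

lemma measurable_pastFiltration (hX : ∀ i, Measurable (X i)) {n i : ℕ} (hi : i < n) :
    Measurable[pastFiltration hX n] (X i) :=
  (comap_measurable (X i)).mono
    (le_biSup (fun i => MeasurableSpace.comap (X i) inferInstance) (Set.mem_Iio.2 hi)) le_rfl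

lemma isENNRealSupermartingale_prod (hX : ∀ i, Measurable (X i)) (hindep : iIndepFun X P)
    {v : 𝒳 → ℝ≥0∞} (hv : Measurable v) (hv1 : ∀ i, ∫⁻ ω, v (X i ω) ∂P ≤ 1) :
    IsENNRealSupermartingale (fun n ω => ∏ i : Fin n, v (X i ω)) (pastFiltration hX) P where
  measurable n := Finset.measurable_prod _ fun i _ => hv.comp (measurable_pastFiltration hX i.2)
  setLIntegral_succ_le n s hs := by
    have hpast : Measurable[pastFiltration hX n] (s.indicator fun ω => ∏ i : Fin n, v (X i ω)) :=
      (Finset.measurable_prod _ fun i _ =>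
        hv.comp (measurable_pastFiltration hX i.2)).indicator hs
    have hind : Indep (pastFiltration hX n) (MeasurableSpace.comap (X n) inferInstance) P := by
      simpa [pastFiltration] using indep_iSup_of_disjoint (fun i => (hX i).comap_le) hindep
        (S := Set.Iio n) (T := {n}) (by simp)
    have hs' : MeasurableSet s := (pastFiltration hX).le n s hs
    calc ∫⁻ ω in s, ∏ i : Fin (n + 1), v (X i ω) ∂P
        = ∫⁻ ω, s.indicator (fun ω => ∏ i : Fin n, v (X i ω)) ω * v (X n ω) ∂P := by
          rw [← lintegral_indicator hs']
          congr with ω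
          by_cases hω : ω ∈ s <;> simp [hω, Fin.prod_univ_castSucc]
      _ = (∫⁻ ω in s, ∏ i : Fin n, v (X i ω) ∂P) * ∫⁻ ω, v (X n ω) ∂P := by
          rw [← lintegral_indicator hs']
          exact lintegral_mul_eq_lintegral_mul_lintegral_of_independent_measurableSpace
            ((pastFiltration hX).le n) (hX n).comap_le hind hpast
            (hv.comp (comap_measurable (X n)))
      _ ≤ ∫⁻ ω in s, ∏ i : Fin n, v (X i ω) ∂P := mul_le_of_le_one_right' (hv1 n)

lemma isENNRealSupermartingale_lintegral_prod [SFinite P] (hX : ∀ i, Measurable (X i))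
    (hindep : iIndepFun X P) {S : Type*} [MeasurableSpace S] {ρ : Measure S} [SFinite ρ]
    {L : S → 𝒳 → ℝ≥0∞} (hL : Measurable (Function.uncurry L))
    (hL1 : ∀ᵐ s ∂ρ, ∀ i, ∫⁻ ω, L s (X i ω) ∂P ≤ 1) :
    IsENNRealSupermartingale (fun n ω => ∫⁻ s, ∏ i : Fin n, L s (X i ω) ∂ρ)
      (pastFiltration hX) P := by
  refine .lintegral (fun n => Finset.measurable_prod _ fun i _ => ?_) (hL1.mono fun s hs =>
    isENNRealSupermartingale_prod hX hindep (hL.comp measurable_prodMk_left) hs)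
  exact hL.comp (measurable_snd.prodMk ((measurable_pastFiltration hX i.2).comp measurable_fst))

end Ville
section PACBayesBound

variable {Ω 𝒳 Θ : Type*} {f : Θ → 𝒳 → ℝ}

lemma empiricalMean_mem_Icc {θ : Θ} (hf01 : ∀ x, f θ x ∈ Set.Icc (0 : ℝ) 1) {n : ℕ}
    (x : Fin n → 𝒳) : empiricalMean f x θ ∈ Set.Icc (0 : ℝ) 1 := by
  refine ⟨div_nonneg (Finset.sum_nonneg fun i _ => (hf01 (x i)).1) n.cast_nonneg,
    div_le_one_of_le₀ ?_ n.cast_nonneg⟩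
  simpa using Finset.sum_le_sum fun i (_ : i ∈ Finset.univ) => (hf01 (x i)).2

lemma trueMean_mem_Icc [MeasurableSpace Ω] [MeasurableSpace 𝒳] {P : Measure Ω}
    [IsProbabilityMeasure P] {Y : Ω → 𝒳} (hY : Measurable Y) {θ : Θ} (hfm : Measurable (f θ))
    (hf01 : ∀ x, f θ x ∈ Set.Icc (0 : ℝ) 1) :
    trueMean f P Y θ ∈ Set.Icc (0 : ℝ) 1 :=
  (convex_Icc 0 1).integral_mem isClosed_Icc (ae_of_all _ fun ω => hf01 (Y ω))
    (Integrable.of_mem_Icc 0 1 (hfm.comp hY).aemeasurable (ae_of_all _ fun ω => hf01 (Y ω)))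

variable [MeasurableSpace Θ]

lemma measurable_empiricalMean (hf : ∀ x, Measurable fun θ => f θ x) {n : ℕ}
    (x : Fin n → 𝒳) : Measurable (empiricalMean f x) :=
  (Finset.measurable_sum _ fun i _ => hf (x i)).div_const _

instance isProbabilityMeasure_betaMeasure_half :
    IsProbabilityMeasure (betaMeasure (1 / 2) (1 / 2)) :=
  isProbabilityMeasureBeta one_half_pos one_half_pos

/-- The wealth at time `n` of the gambler who spreads the initial wealth `1` over the parameters
`(θ, q)` according to `P₀.prod (betaMeasure (1 / 2) (1 / 2))` and, for each of them, bets on the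
mean `q` of `f θ` against the mean `m θ`. -/
noncomputable def mixtureWealth (f : Θ → 𝒳 → ℝ) (m : Θ → ℝ) (P₀ : Measure Θ) {n : ℕ}
    (x : Fin n → 𝒳) : ℝ≥0∞ :=
  ∫⁻ s, ∏ i, bernoulliLikelihoodRatio (m s.1) s.2 (f s.1 (x i))
    ∂P₀.prod (betaMeasure (1 / 2) (1 / 2))

lemma mixtureWealth_zero (m : Θ → ℝ) (P₀ : Measure Θ) [IsProbabilityMeasure P₀] (x : Fin 0 → 𝒳) :
    mixtureWealth f m P₀ x = 1 := by
  simp only [mixtureWealth, Finset.univ_eq_empty, Finset.prod_empty, lintegral_one, measure_univ]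

variable [MeasurableSpace Ω] [MeasurableSpace 𝒳]

lemma measurable_trueMean {P : Measure Ω} [SFinite P] (hf : Measurable (Function.uncurry f))
    {Y : Ω → 𝒳} (hY : Measurable Y) : Measurable (trueMean f P Y) := by
  have hfY : Measurable fun z : Θ × Ω => f z.1 (Y z.2) :=
    hf.comp (measurable_fst.prodMk (hY.comp measurable_snd))
  exact hfY.stronglyMeasurable.integral_prod_right.measurable

lemma lintegral_exp_mul_bernoulliKL_le_mixtureWealth {P₀ : Measure Θ} [SFinite P₀]
    (hf : Measurable (Function.uncurry f)) (hf01 : ∀ θ x, f θ x ∈ Set.Icc (0 : ℝ) 1)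
    {m : Θ → ℝ} (hm : Measurable m) (hm01 : ∀ θ, m θ ∈ Set.Icc (0 : ℝ) 1)
    {n : ℕ} (hn : n ≠ 0) (x : Fin n → 𝒳) :
    ∫⁻ θ, EReal.exp (n * bernoulliKL (empiricalMean f x θ) (m θ)) ∂P₀ ≤
      ENNReal.ofReal (ktRegret n) * mixtureWealth f m P₀ x := by
  have hprod : Measurable fun s : Θ × ℝ =>
      ∏ i, bernoulliLikelihoodRatio (m s.1) s.2 (f s.1 (x i)) :=
    Finset.measurable_prod _ fun i _ => measurable_bernoulliLikelihoodRatio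
      (hm.comp measurable_fst) measurable_snd (hf.comp (measurable_fst.prodMk measurable_const))
  rw [mixtureWealth, lintegral_prod _ hprod.aemeasurable,
    ← lintegral_const_mul _ hprod.lintegral_prod_right']
  exact lintegral_mono fun θ =>
    exp_mul_bernoulliKL_le_lintegral_prod hn (fun i => hf01 θ (x i)) (hm01 θ)

lemma bernoulliKL_integral_le_of_mixtureWealth_le {Q P₀ : Measure Θ} [IsProbabilityMeasure Q]
    [IsProbabilityMeasure P₀] (hf : Measurable (Function.uncurry f))
    (hf01 : ∀ θ x, f θ x ∈ Set.Icc (0 : ℝ) 1) {m : Θ → ℝ} (hm : Measurable m)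
    (hm01 : ∀ θ, m θ ∈ Set.Icc (0 : ℝ) 1) {n : ℕ} (hn : n ≠ 0) {x : Fin n → 𝒳} {c : ℝ}
    (hc : 0 < c) (hwealth : mixtureWealth f m P₀ x ≤ ENNReal.ofReal c) :
    bernoulliKL (∫ θ, empiricalMean f x θ ∂Q) (∫ θ, m θ ∂Q) ≤
      (complexity n Q P₀ + (Real.log c : EReal)) / n := by
  rw [EReal.le_div_iff_mul_le (by exact_mod_cast hn.bot_lt) (EReal.natCast_ne_top n), mul_comm]
  calc n * bernoulliKL (∫ θ, empiricalMean f x θ ∂Q) (∫ θ, m θ ∂Q)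
      ≤ klDiv Q P₀ +
          ENNReal.log (∫⁻ θ, EReal.exp (n * bernoulliKL (empiricalMean f x θ) (m θ)) ∂P₀) :=
        natCast_mul_bernoulliKL_integral_le (measurable_empiricalMean
          (fun x => hf.comp measurable_prodMk_right) x) hm
          (fun θ => empiricalMean_mem_Icc (hf01 θ) x) hm01 n
    _ ≤ klDiv Q P₀ + ENNReal.log (ENNReal.ofReal (ktRegret n) * ENNReal.ofReal c) := by
        gcongr
        exact (lintegral_exp_mul_bernoulliKL_le_mixtureWealth hf hf01 hm hm01 hn x).trans
          (by gcongr)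
    _ = complexity n Q P₀ + (Real.log c : EReal) := by
        rw [ENNReal.log_mul_add, ENNReal.log_ofReal_of_pos (ktRegret_pos n.cast_nonneg),
          ENNReal.log_ofReal_of_pos hc, ← add_assoc, complexity, ktRegret]

lemma isENNRealSupermartingale_mixtureWealth {P : Measure Ω} [IsProbabilityMeasure P]
    {X : ℕ → Ω → 𝒳} (hX : ∀ i, Measurable (X i)) (hindep : iIndepFun X P)
    (hf : Measurable (Function.uncurry f)) (hf01 : ∀ θ x, f θ x ∈ Set.Icc (0 : ℝ) 1)
    {m : Θ → ℝ} (hmean : ∀ i θ, trueMean f P (X i) θ = m θ) (P₀ : Measure Θ) [SFinite P₀] :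
    IsENNRealSupermartingale (fun n ω => mixtureWealth f m P₀ fun i : Fin n => X i ω)
      (pastFiltration hX) P := by
  have hm : Measurable m := funext (hmean 0) ▸ measurable_trueMean hf (hX 0)
  refine isENNRealSupermartingale_lintegral_prod hX hindep
    (L := fun (s : Θ × ℝ) x => bernoulliLikelihoodRatio (m s.1) s.2 (f s.1 x))
    (measurable_bernoulliLikelihoodRatio (hm.comp (measurable_fst.comp measurable_fst))
      (measurable_snd.comp measurable_fst)
      (hf.comp ((measurable_fst.comp measurable_fst).prodMk measurable_snd))) ?_
  filter_upwards [Measure.quasiMeasurePreserving_snd.ae (ae_mem_Ioo_betaMeasure (1 / 2) (1 / 2))]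
    with s hs i
  rw [← hmean i]
  exact lintegral_bernoulliLikelihoodRatio_le_one ((hf.comp measurable_prodMk_left).comp (hX i))
    (fun ω => hf01 s.1 _) (Set.Ioo_subset_Icc_self hs)

end PACBayesBound

end PACBayes

theorem proposition2_general {Ω 𝒳 Θ : Type*} [MeasurableSpace Ω] [MeasurableSpace 𝒳]
    [MeasurableSpace Θ] (P : Measure Ω) [IsProbabilityMeasure P]
    (X : ℕ → Ω → 𝒳) (hX : ∀ i, Measurable (X i)) (hindep : iIndepFun X P)
    (f : Θ → 𝒳 → ℝ) (hf : Measurable (Function.uncurry f))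
    (hf01 : ∀ θ x, f θ x ∈ Set.Icc (0 : ℝ) 1)
    (hmean : ∀ i θ, PACBayes.trueMean f P (X i) θ = PACBayes.trueMean f P (X 0) θ)
    (P₀ : Measure Θ) [IsProbabilityMeasure P₀] {δ : ℝ} (hδ : 0 < δ) :
    ∃ E : Set Ω, MeasurableSet E ∧ 1 - δ ≤ P.real E ∧
      ∀ ω ∈ E, ∀ n : ℕ, 1 ≤ n → ∀ Q : Measure Θ, IsProbabilityMeasure Q →
        PACBayes.bernoulliKL (∫ θ, PACBayes.empiricalMean f (fun i : Fin n => X i ω) θ ∂Q)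
            (∫ θ, PACBayes.trueMean f P (X 0) θ ∂Q) ≤
          (PACBayes.complexity n Q P₀ + ((Real.log (1 / δ) : ℝ) : EReal)) / (n : EReal) := by
  have hμ : Measurable (PACBayes.trueMean f P (X 0)) := PACBayes.measurable_trueMean hf (hX 0)
  have hμ01 (θ : Θ) : PACBayes.trueMean f P (X 0) θ ∈ Set.Icc (0 : ℝ) 1 :=
    PACBayes.trueMean_mem_Icc (hX 0) (hf.comp measurable_prodMk_left) (hf01 θ)
  have hsuper := PACBayes.isENNRealSupermartingale_mixtureWealth hX hindep hf hf01 hmean P₀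
  obtain ⟨E, hE, hPE, hwealth⟩ :=
    hsuper.exists_measurableSet_forall_le (by simp [PACBayes.mixtureWealth_zero]) hδ
  exact ⟨E, hE, hPE, fun ω hω n hn Q _ =>
    PACBayes.bernoulliKL_integral_le_of_mixtureWealth_le hf hf01 hμ hμ01
      (Nat.one_le_iff_ne_zero.1 hn) (one_div_pos.2 hδ) (hwealth ω hω n)⟩

theorem proposition2 {Ω 𝒳 Θ : Type*} [MeasurableSpace Ω] [MeasurableSpace 𝒳] [MeasurableSpace Θ]
    (P : Measure Ω) [IsProbabilityMeasure P]
    (X : ℕ → Ω → 𝒳) (hX : ∀ i, Measurable (X i)) (hindep : iIndepFun X P)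
    (hident : ∀ i, IdentDistrib (X i) (X 0) P P)
    (f : Θ → 𝒳 → ℝ) (hf : Measurable (Function.uncurry f))
    (hf01 : ∀ θ x, f θ x ∈ Set.Icc (0 : ℝ) 1)
    (P₀ : Measure Θ) [IsProbabilityMeasure P₀]
    (δ : ℝ) (hδ : δ ∈ Set.Ioc (0 : ℝ) 1) :
    ∃ E : Set Ω, MeasurableSet E ∧ 1 - δ ≤ P.real E ∧
      ∀ ω ∈ E, ∀ n : ℕ, 1 ≤ n →
        ∀ κ : Kernel (Fin n → 𝒳) Θ, IsMarkovKernel κ →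
          PACBayes.bernoulliKL
              (∫ θ, PACBayes.empiricalMean f (fun i : Fin n => X i ω) θ
                ∂(κ fun i : Fin n => X i ω))
              (∫ θ, PACBayes.trueMean f P (X 0) θ ∂(κ fun i : Fin n => X i ω)) ≤
            (PACBayes.complexity n (κ fun i : Fin n => X i ω) P₀ +
              ((Real.log (1 / δ) : ℝ) : EReal)) / (n : EReal) := by
  have hmean (i : ℕ) (θ : Θ) : PACBayes.trueMean f P (X i) θ = PACBayes.trueMean f P (X 0) θ :=
    ((hident i).comp (hf.comp measurable_prodMk_left)).integral_eq
  obtain ⟨E, hE, hPE, hbound⟩ := proposition2_general P X hX hindep f hf hf01 hmean P₀ hδ.1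
  exact ⟨E, hE, hPE, fun ω hω n hn κ _ => hbound ω hω n hn _ inferInstance⟩
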